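/- Let $A$ be a tree with vertex set $V$ and let $f\colon V\to I$ be a coloring of its vertices. Write $\mathrm{Aut}_f(A)$ for the group of automorphisms $\alpha$ of $A$ with $f\circ\alpha=f$, and $\mathrm{Aut}_f^+(A)$ for the subgroup generated by the elements of $\mathrm{Aut}_f(A)$ that fix both endpoints of some edge of $A$. The coloring $f$ is \emph{normal} if it is onto and $\mathrm{Aut}_f(A)$ acts transitively on each color class $f^{-1}[i]$; in that case the \emph{code} of $(A,f)$ is the function $a$ from $I\times I$ to cardinal numbers such that every vertex of color $i$ has exactly $a(i,j)$ neighbors of color $j$. A group $G$ is \emph{boundedly simple} if there is a natural number $N$ such that for all nontrivial $g,h\in G$ the element $h$ is a product of at most $N$ conjugates in $G$ of $g$ and $g^{-1}$. Let $(A,f\colon V\to I)$ be a colored tree, with $f$ normal and with code $a$, such that no vertex of $A$ is fixed by all of $\mathrm{Aut}_f^+(A)$. Let $k\notin I$, let $I'=I\cup\{k\}$, and let $a'$ be a function from $I'\times I'$ to cardinal numbers which extends $a$, such that for every $i\in I$, $a'(i,k)=0$ if and only if $a'(k,i)=0$, and such that $a'(k,j)\ge 2$ for some $j\in I$. If $(A',f'\colon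 V'\to I')$ is a tree with normal coloring $f'$ whose code is $a'$, then $\mathrm{Aut}_{f'}^+(A')$ is not boundedly simple. -/

import Mathlib

namespace ColoredTree

/-- `G` is `N`-boundedly simple: for all nontrivial `g, h`, the element `h` is a product of at most
`N` conjugates (in `G`) of `g` and `g⁻¹`. -/
def IsNBoundedlySimple (G : Type*) [Group G] (N : ℕ) : Prop :=
  ∀ g h : G, g ≠ 1 → h ≠ 1 →
    ∃ l : List G, l.length ≤ N ∧ (∀ c ∈ l, IsConj g c ∨ IsConj g⁻¹ c) ∧ l.prod = h

/-- `G` is boundedly simple: it is `N`-boundedly simple for some natural number `N`. -/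
def IsBoundedlySimple (G : Type*) [Group G] : Prop :=
  ∃ N : ℕ, IsNBoundedlySimple G N

variable {V : Type*} {I : Type*}

/-- The group `Aut_f(A)` of automorphisms of the graph `A` preserving the vertex coloring `f`. -/
def colorAut (A : SimpleGraph V) (f : V → I) : Subgroup (A ≃g A) where
  carrier := {φ | ∀ x, f (φ x) = f x}
  one_mem' := fun _ => rfl
  mul_mem' := by
    intro φ ψ hφ hψ x
    exact (hφ (ψ x)).trans (hψ x)
  inv_mem' := by
    intro φ hφ x
    have h := hφ (φ⁻¹ x)
    rw [RelIso.apply_inv_self] at h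
    exact h.symm

/-- `H⁺`: the subgroup generated by the (pointwise) stabilizers in `H` of the edges of `A`. -/
def plus {A : SimpleGraph V} (H : Subgroup (A ≃g A)) : Subgroup (A ≃g A) :=
  Subgroup.closure {φ | φ ∈ H ∧ ∃ x y, A.Adj x y ∧ φ x = x ∧ φ y = y}

/-- The group `Aut_f⁺(A)`. -/
def colorAutPlus (A : SimpleGraph V) (f : V → I) : Subgroup (A ≃g A) :=
  plus (colorAut A f)

/-- A coloring `f` is normal: it is onto and `Aut_f(A)` is transitive on every color class. -/
def IsNormalColoring (A : SimpleGraph V) (f : V → I) : Prop :=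
  Function.Surjective f ∧ ∀ x y, f x = f y → ∃ φ ∈ colorAut A f, φ x = y

end ColoredTree

universe u v

namespace ColoredTree

/-- `a` is the code of `(A, f)`: the coloring `f` is normal and every vertex of color `i` has
exactly `a i j` neighbors of color `j`. -/
def IsCode {V : Type u} {I : Type v} (A : SimpleGraph V) (f : V → I)
    (a : I → I → Cardinal.{u}) : Prop :=
  IsNormalColoring A f ∧
    ∀ (x : V) (j : I), Cardinal.mk {y : V // A.Adj x y ∧ f y = j} = a (f x) j

end ColoredTree

/-! The obstruction is an unbounded antisymmetric quasimorphism of Brooks type. Label the vertices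
of `A'` by whether their color is the new one, and fix a vertex `p` of the new color. The geodesic
from `p` to `g p` then spells a binary word; `q g` counts a fixed word in it, minus the count in the
reversed word. Geodesic triangles are tripods, so `q` is additive up to a constant, and an unbounded
such `q` excludes bounded simplicity (`not_isBoundedlySimple_of_quasimorphism`).

To make `q` large, words with prescribed gaps between new-colored vertices are needed. Since
`Aut_f⁺(A)` fixes no vertex, `A` has arbitrarily long "turns" starting at a vertex of color `j`
(`exists_isTurn`, `exists_isTurn_length_ge`). The codes agree on `I`, so a turn lifts to `A'` from
any neighbor of `p` of color `j`. A rotation at its bend lies in `Aut⁺` and carries `p` across a gap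
determined by the length of the turn (`IsTurn.exists_movesAcross`); it exists because local
isomorphisms extend (`exists_colorAut_extending`). As `p` has two neighbors of color `j`, such moves
compose without backtracking, realizing `a, b, c, c` repeated `n` times with `a, b, c` distinct. The
pair `a, b` occurs `n` times in this sequence and never in its reverse. -/

namespace ColoredTree

/-! ### Walks without backtracking and geodesics in trees -/

section NonBacktracking

variable {V : Type*} {W : Type*} {A : SimpleGraph V} {B : SimpleGraph W}

/-- The list `l` of vertices is a walk of `A` without backtracking. -/
def NonBack (A : SimpleGraph V) : List V → Prop
  | x :: y :: z :: l => A.Adj x y ∧ x ≠ z ∧ NonBack A (y :: z :: l)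
  | [x, y] => A.Adj x y
  | _ => True

/-- Backtracking is visible in three consecutive vertices, so pieces overlapping in an edge can be
glued. -/
theorem nonBack_glue : ∀ (l₁ : List V) (x y : V) (l₂ : List V),
    NonBack A (l₁ ++ x :: y :: l₂) ↔ NonBack A (l₁ ++ [x, y]) ∧ NonBack A (x :: y :: l₂)
  | [], x, y, [] => by simp [NonBack]
  | [], x, y, z :: l => by simp only [List.nil_append, NonBack]; tauto
  | [a], x, y, l₂ => by
    have : NonBack A (x :: y :: l₂) → A.Adj x y := by
      rcases l₂ with _ | ⟨u, l₂⟩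
      exacts [id, And.left]
    simp only [List.cons_append, List.nil_append, NonBack]
    tauto
  | [a, b], x, y, l₂ => by
    have := nonBack_glue [b] x y l₂
    simp only [List.cons_append, List.nil_append, NonBack] at this ⊢
    tauto
  | a :: b :: c :: l, x, y, l₂ => by
    have := nonBack_glue (b :: c :: l) x y l₂
    simp only [List.cons_append, NonBack] at this ⊢
    tauto

theorem NonBack.tail : ∀ {x : V} {l : List V}, NonBack A (x :: l) → NonBack A l
  | _, [], _ => trivial
  | _, [_], _ => trivial
  | _, _ :: _ :: _, h => h.2.2

theorem NonBack.adj : ∀ {x y : V} {l : List V}, NonBack A (x :: y :: l) → A.Adj x y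
  | _, _, [], h => h
  | _, _, _ :: _, h => h.1

theorem NonBack.reverse : ∀ {l : List V}, NonBack A l → NonBack A l.reverse
  | [], h => h
  | [_], h => h
  | [x, y], h => (show A.Adj x y from h).symm
  | x :: y :: z :: l, h => by
    have ih := NonBack.reverse h.2.2
    simp only [List.reverse_cons, List.append_assoc, List.cons_append, List.nil_append] at ih ⊢
    rw [nonBack_glue]
    exact ⟨ih, h.2.2.adj.symm, h.2.1.symm, h.1.symm⟩

/-- A locally injective homomorphism preserves the absence of backtracking. -/
theorem NonBack.map (F : V → W) (hF : ∀ x y, A.Adj x y → B.Adj (F x) (F y))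
    (hinj : ∀ x y z, A.Adj x y → A.Adj x z → F y = F z → y = z) :
    ∀ {l : List V}, NonBack A l → NonBack B (l.map F)
  | [], _ => trivial
  | [_], _ => trivial
  | [x, y], h => hF x y h
  | _ :: y :: _ :: _, h =>
    ⟨hF _ _ h.1, fun e => h.2.1 (hinj y _ _ h.1.symm h.2.2.adj e),
      NonBack.map F hF hinj h.2.2⟩

theorem NonBack.map_iso (φ : A ≃g A) {l : List V} (h : NonBack A l) :
    NonBack A (l.map φ) :=
  h.map φ (fun _ _ hxy => φ.map_rel_iff.2 hxy) (fun _ _ _ _ _ e => φ.injective e)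

theorem nonBack_support {x y : V} (p : A.Walk x y) (hp : p.IsPath) : NonBack A p.support := by
  induction p with
  | nil => trivial
  | cons h p ih =>
    rw [SimpleGraph.Walk.cons_isPath_iff] at hp
    have := ih hp.1
    cases p with
    | nil => exact h
    | cons h' q =>
      rw [SimpleGraph.Walk.support_cons, SimpleGraph.Walk.support_cons] at *
      cases q with
      | nil => exact ⟨h, fun e => hp.2 (by simp [e]), this⟩
      | cons h'' q =>
        rw [SimpleGraph.Walk.support_cons] at *
        exact ⟨h, fun e => hp.2 (by simp [e]), this⟩

theorem exists_path_of_nonBack (hA : A.IsTree) : ∀ (l : List V) (x : V), NonBack A (x :: l) →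
    ∃ (y : V) (p : A.Walk x y), p.IsPath ∧ p.support = x :: l
  | [], x, _ => ⟨x, .nil, by simp, rfl⟩
  | [y], x, h => by
    replace h : A.Adj x y := h
    exact ⟨y, .cons h .nil, by simpa [SimpleGraph.Walk.cons_isPath_iff] using A.ne_of_adj h, rfl⟩
  | y :: z :: l, x, h => by
    obtain ⟨u, p, hp, hs⟩ := exists_path_of_nonBack hA (z :: l) y h.2.2
    refine ⟨u, .cons h.1 p, ?_, by simp [hs]⟩
    rw [SimpleGraph.Walk.cons_isPath_iff]
    refine ⟨hp, fun hx => ?_⟩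
    classical
    have h1 : (p.takeUntil x hx).IsPath := hp.takeUntil hx
    have h2 : (SimpleGraph.Walk.cons h.1.symm .nil : A.Walk y x).IsPath := by
      simpa [SimpleGraph.Walk.cons_isPath_iff] using (A.ne_of_adj h.1).symm
    -- Uniqueness of paths forces `p` to begin with the edge from `y` to `x`, so `z = x`: a
    -- backtrack.
    have h3 : p.takeUntil x hx = .cons h.1.symm .nil := 
      congrArg Subtype.val ((hA.isAcyclic.subsingleton_path _ _).elim (⟨_, h1⟩ : A.Path y x) ⟨_, h2⟩)
    have h4 := p.take_spec hx
    rw [h3] at h4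
    have h5 := congrArg SimpleGraph.Walk.support h4
    rw [hs] at h5
    simp only [SimpleGraph.Walk.cons_append, SimpleGraph.Walk.nil_append,
      SimpleGraph.Walk.support_cons, List.cons.injEq, true_and] at h5
    have h6 := (p.dropUntil x hx).cons_tail_support
    rw [← h6] at h5
    exact h.2.1 (List.cons.inj h5).1

theorem NonBack.nodup (hA : A.IsTree) {l : List V} (h : NonBack A l) : l.Nodup := by
  rcases l with _ | ⟨x, l⟩
  · simp
  · obtain ⟨y, p, hp, hs⟩ := exists_path_of_nonBack hA l x h
    exact hs ▸ hp.support_nodup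

theorem NonBack.unique (hA : A.IsTree) {x : V} {l l' : List V} (h : NonBack A (x :: l))
    (h' : NonBack A (x :: l')) (hl : (x :: l).getLast? = (x :: l').getLast?) : l = l' := by
  obtain ⟨y, p, hp, hs⟩ := exists_path_of_nonBack hA l x h
  obtain ⟨y', p', hp', hs'⟩ := exists_path_of_nonBack hA l' x h'
  have e : y = y' := by
    rw [← hs, ← hs', List.getLast?_eq_some_getLast (by simp),
      List.getLast?_eq_some_getLast (by simp)] at hl
    simpa using hl
  subst e
  have : p = p' := congrArg Subtype.val
    ((hA.isAcyclic.subsingleton_path _ _).elim (⟨p, hp⟩ : A.Path x y) ⟨p', hp'⟩)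
  subst this
  simpa using hs.symm.trans hs'

theorem exists_nonBack (hA : A.IsTree) (x y : V) :
    ∃ l, NonBack A (x :: l) ∧ (x :: l).getLast? = some y := by
  obtain ⟨p, hp, -⟩ := hA.existsUnique_path x y
  refine ⟨p.support.tail, ?_, ?_⟩
  · rw [p.cons_tail_support]
    exact nonBack_support p hp
  · rw [p.cons_tail_support, List.getLast?_eq_some_getLast (by simp)]
    simp

/-- The list of the vertices after `x` on the geodesic from `x` to `y`. -/
noncomputable def geod (hA : A.IsTree) (x y : V) : List V := (exists_nonBack hA x y).choose

theorem nonBack_geod (hA : A.IsTree) (x y : V) : NonBack A (x :: geod hA x y) :=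
  (exists_nonBack hA x y).choose_spec.1

theorem getLast_geod (hA : A.IsTree) (x y : V) : (x :: geod hA x y).getLast? = some y :=
  (exists_nonBack hA x y).choose_spec.2

theorem eq_cons_geod (hA : A.IsTree) {x y : V} {l : List V} (h : NonBack A l)
    (hx : l.head? = some x) (hy : l.getLast? = some y) : l = x :: geod hA x y := by
  rcases l with _ | ⟨x', l⟩
  · simp at hx
  · obtain rfl : x' = x := by simpa using hx
    rw [h.unique hA (nonBack_geod hA x' y) (hy.trans (getLast_geod hA x' y).symm)]

theorem geod_reverse (hA : A.IsTree) (x y : V) :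
    (x :: geod hA x y).reverse = y :: geod hA y x :=
  eq_cons_geod hA (nonBack_geod hA x y).reverse
    (by rw [List.head?_reverse, getLast_geod]) (by simp)

theorem geod_map (hA : A.IsTree) (φ : A ≃g A) (x y : V) :
    (x :: geod hA x y).map φ = φ x :: geod hA (φ x) (φ y) :=
  eq_cons_geod hA ((nonBack_geod hA x y).map_iso φ) (by simp)
    (by rw [List.getLast?_map, getLast_geod]; rfl)

/-- The two walks separate at the last vertex `m` of their common initial part; this is the center
of the tripod. -/
theorem nonBack_tripod : ∀ (l₁ l₂ : List V) (y : V), NonBack A (y :: l₁) → NonBack A (y :: l₂) →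
    ∃ c m a b, y :: l₁ = c ++ m :: a ∧ y :: l₂ = c ++ m :: b ∧ NonBack A (a.reverse ++ m :: b)
  | [], l₂, y, _, h₂ => ⟨[], y, [], l₂, rfl, rfl, h₂⟩
  | l₁, [], y, h₁, _ => ⟨[], y, l₁, [], rfl, rfl, by simpa using h₁.reverse⟩
  | u :: l₁, v :: l₂, y, h₁, h₂ => by
    by_cases e : u = v
    · subst e
      obtain ⟨c, m, a, b, e₁, e₂, h⟩ := nonBack_tripod l₁ l₂ u h₁.tail h₂.tail
      exact ⟨y :: c, m, a, b, by rw [e₁]; rfl, by rw [e₂]; rfl, h⟩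
    · refine ⟨[], y, u :: l₁, v :: l₂, rfl, rfl, ?_⟩
      have h := h₁.reverse
      simp only [List.reverse_cons, List.append_assoc, List.cons_append, List.nil_append] at h ⊢
      rw [nonBack_glue]
      exact ⟨h, h₁.adj.symm, e, h₂⟩

end NonBacktracking

/-! ### Counting subwords, and words with prescribed gaps -/

section Counting

/-- The number of occurrences of `w` as a block of consecutive letters of `l`. -/
def occ (w : List Bool) : List Bool → ℕ
  | [] => 0
  | x :: l => (if w <+: x :: l then 1 else 0) + occ w l

theorem occ_append_ge (w : List Bool) (l₂ : List Bool) :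
    ∀ l₁ : List Bool, occ w l₁ + occ w l₂ ≤ occ w (l₁ ++ l₂)
  | [] => by simp [occ]
  | x :: l => by
    have ih := occ_append_ge w l₂ l
    have : w <+: x :: l → w <+: x :: (l ++ l₂) := fun h => h.trans (List.prefix_append (x :: l) l₂)
    simp only [occ, List.cons_append]
    split_ifs <;> first | omega | (exfalso; tauto)

/-- An occurrence crossing the junction starts among the last `w.length` letters of `l₁`. The
minimum with `l₁.length` makes the induction on `l₁` go through. -/
theorem occ_append_le_min (w : List Bool) (l₂ : List Bool) :
    ∀ l₁ : List Bool, occ w (l₁ ++ l₂) ≤ occ w l₁ + occ w l₂ + min l₁.length w.length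
  | [] => by simp [occ]
  | x :: l => by
    have ih := occ_append_le_min w l₂ l
    simp only [occ, List.cons_append, List.length_cons]
    by_cases hw : w.length ≤ l.length + 1
    · have : w <+: x :: (l ++ l₂) → w <+: x :: l := fun h =>
        List.prefix_of_prefix_length_le h (List.prefix_append (x :: l) l₂) (by simpa using hw)
      split_ifs <;> first | omega | (exfalso; tauto)
    · split_ifs <;> omega

theorem occ_append_le (w l₁ l₂ : List Bool) :
    occ w (l₁ ++ l₂) ≤ occ w l₁ + occ w l₂ + w.length :=
  (occ_append_le_min w l₂ l₁).trans (by omega)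

/-- The number of occurrences of `w` in `l`, minus the number of its occurrences in the
reverse of `l`. -/
def signedOcc (w l : List Bool) : ℤ := occ w l - occ w l.reverse

theorem signedOcc_reverse (w l : List Bool) : signedOcc w l.reverse = -signedOcc w l := by
  simp [signedOcc]

theorem abs_signedOcc_append (w l₁ l₂ : List Bool) :
    |signedOcc w (l₁ ++ l₂) - signedOcc w l₁ - signedOcc w l₂| ≤ w.length := by
  have h₁ := occ_append_ge w l₂ l₁
  have h₂ := occ_append_le w l₁ l₂
  have h₃ := occ_append_ge w l₁.reverse l₂.reverse
  have h₄ := occ_append_le w l₂.reverse l₁.reverse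
  simp only [signedOcc, List.reverse_append]
  rw [abs_le]
  constructor <;> omega

theorem abs_signedOcc_singleton (w : List Bool) (x : Bool) : |signedOcc w [x]| ≤ 0 := by
  simp [signedOcc]

/-- The word whose letters `true` are separated by blocks of letters `false` of the prescribed
lengths. -/
def gapWord : List ℕ → List Bool
  | [] => [true]
  | m :: ms => true :: (List.replicate m false ++ gapWord ms)

theorem gapWord_eq_cons : ∀ ms, ∃ l, gapWord ms = true :: l
  | [] => ⟨_, rfl⟩
  | _ :: _ => ⟨_, rfl⟩

theorem gapWord_append_singleton (m : ℕ) : ∀ ms : List ℕ,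
    gapWord (ms ++ [m]) = gapWord ms ++ (List.replicate m false ++ [true])
  | [] => by simp [gapWord]
  | n :: ms => by simp [gapWord, gapWord_append_singleton m ms]

theorem gapWord_reverse : ∀ ms : List ℕ, (gapWord ms).reverse = gapWord ms.reverse
  | [] => rfl
  | m :: ms => by
    simp [gapWord_append_singleton, ← gapWord_reverse ms, gapWord]

theorem occ_replicate_append (w l : List Bool) : ∀ m : ℕ,
    occ (true :: w) (List.replicate m false ++ l) = occ (true :: w) l
  | 0 => by simp
  | m + 1 => by simp [List.replicate_succ, occ, occ_replicate_append w l m]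

theorem replicate_prefix {u v : List Bool} : ∀ {a m : ℕ},
    List.replicate a false ++ true :: u <+: List.replicate m false ++ true :: v →
      a = m ∧ u <+: v
  | 0, 0, h => by simpa using h
  | 0, m + 1, h => by simp [List.replicate_succ] at h
  | a + 1, 0, h => by simp [List.replicate_succ] at h
  | a + 1, m + 1, h => by
    simp only [List.replicate_succ, List.cons_append, List.cons_prefix_cons, true_and] at h
    have := replicate_prefix h
    exact ⟨by rw [this.1], this.2⟩

theorem gapWord_prefix_gapWord {a b : ℕ} : ∀ {ms : List ℕ}, gapWord [a, b] <+: gapWord ms →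
    ∃ l, ms = a :: b :: l
  | [], h => by simp [gapWord] at h
  | [m], h => by
    simp only [gapWord, List.cons_prefix_cons, true_and] at h
    simpa using (replicate_prefix h).2
  | m :: n :: ms, h => by
    simp only [gapWord, List.cons_prefix_cons, true_and] at h
    obtain ⟨e, h'⟩ := replicate_prefix h
    obtain ⟨l, hl⟩ := gapWord_eq_cons ms
    rw [hl] at h'
    exact ⟨ms, by rw [e, (replicate_prefix h').1]⟩

theorem occ_gapWord_eq_zero {a b : ℕ} : ∀ {ms : List ℕ},
    ms.IsChain (fun m n => ¬(m = a ∧ n = b)) → occ (gapWord [a, b]) (gapWord ms) = 0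
  | [], _ => by simp [gapWord, occ]
  | m :: ms, h => by
    have ih := occ_gapWord_eq_zero (a := a) (b := b) h.tail
    have hp : ¬gapWord [a, b] <+: gapWord (m :: ms) := fun hp => by
      obtain ⟨l, hl⟩ := gapWord_prefix_gapWord hp
      rw [hl] at h
      simp at h
    have h1 : occ (gapWord [a, b]) (List.replicate m false ++ gapWord ms) = 0 := by
      rw [← ih]
      exact occ_replicate_append _ _ m
    show (if gapWord [a, b] <+: gapWord (m :: ms) then 1 else 0) +
      occ (gapWord [a, b]) (List.replicate m false ++ gapWord ms) = 0
    rw [if_neg hp, h1]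

theorem occ_gapWord_cons_cons (a b : ℕ) (ms : List ℕ) :
    1 + occ (gapWord [a, b]) (gapWord ms) ≤ occ (gapWord [a, b]) (gapWord (a :: b :: ms)) := by
  have hp : gapWord [a, b] <+: gapWord (a :: b :: ms) := by
    obtain ⟨l, hl⟩ := gapWord_eq_cons ms
    simp [gapWord, hl]
  have h := occ_append_ge (gapWord [a, b]) (gapWord ms)
    (List.replicate a false ++ true :: List.replicate b false)
  simp only [List.append_assoc, List.cons_append] at h
  have : occ (gapWord [a, b]) (gapWord (a :: b :: ms)) =
    (if gapWord [a, b] <+: gapWord (a :: b :: ms) then 1 else 0) + occ (gapWord [a, b])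
      (List.replicate a false ++ true :: (List.replicate b false ++ gapWord ms)) := rfl
  rw [this, if_pos hp]
  omega

/-- `n` repetitions of the sequence `a, b, c, c`. -/
def periodicGaps (a b c : ℕ) : ℕ → List ℕ
  | 0 => []
  | n + 1 => a :: b :: c :: c :: periodicGaps a b c n

/-- Reversed, the gaps cycle through `c, c, b, a`, where `a` is never followed by `b`. -/
theorem le_signedOcc_periodicGaps {a b c : ℕ} (hab : a ≠ b) (hac : a ≠ c) (hbc : b ≠ c) (n : ℕ) :
    (n : ℤ) ≤ signedOcc (gapWord [a, b]) (gapWord (periodicGaps a b c n)) := by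
  have h₁ : n ≤ occ (gapWord [a, b]) (gapWord (periodicGaps a b c n)) := by
    induction n with
    | zero => simp
    | succ n ih =>
      have h₁ := occ_gapWord_cons_cons a b (c :: c :: periodicGaps a b c n)
      have h₂ := occ_append_ge (gapWord [a, b]) (gapWord (periodicGaps a b c n))
        (true :: (List.replicate c false ++ true :: List.replicate c false))
      simp only [List.append_assoc, List.cons_append] at h₂
      simp only [periodicGaps]
      have : gapWord (c :: c :: periodicGaps a b c n) = true :: (List.replicate c false ++
        true :: (List.replicate c false ++ gapWord (periodicGaps a b c n))) := rfl
      rw [this] at h₁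
      omega
  have h₂ : occ (gapWord [a, b]) (gapWord (periodicGaps a b c n)).reverse = 0 := by
    rw [gapWord_reverse]
    apply occ_gapWord_eq_zero
    rw [List.isChain_reverse]
    have : ∀ n, (c :: periodicGaps a b c n).IsChain (fun m n => ¬(n = a ∧ m = b)) := by
      intro n
      induction n with
      | zero => simp [periodicGaps]
      | succ n ih =>
        simp only [periodicGaps, List.isChain_cons_cons]
        exact ⟨fun h => hbc h.2.symm, fun h => hab h.1.symm, fun h => hac h.1.symm,
          fun h => hac h.1.symm, ih⟩
    exact (this n).tail
  simp only [signedOcc, h₂]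
  omega

end Counting

/-! ### Quasimorphisms against bounded simplicity -/

section Quasimorphism

/-- On conjugates of a fixed `g` and its inverse `q` is bounded, hence also on products of at most
`N` of them. -/
theorem not_isBoundedlySimple_of_quasimorphism {G : Type*} [Group G] (q : G → ℤ) (C : ℤ)
    (hq : ∀ g h, |q (g * h) - q g - q h| ≤ C) (hinv : ∀ g, q g⁻¹ = -q g)
    (hub : ∀ n : ℕ, ∃ g, (n : ℤ) ≤ q g) : ¬ IsBoundedlySimple G := by
  rintro ⟨N, hN⟩
  have h1 : q 1 = 0 := by
    have := hinv 1
    rw [inv_one] at this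
    omega
  have hne : ∀ g, 0 < q g → g ≠ 1 := by
    rintro g hg rfl
    omega
  obtain ⟨g, hg⟩ := hub 1
  have hconj : ∀ x c : G, |q (x * c * x⁻¹)| ≤ |q c| + 2 * C := by
    intro x c
    have h₁ := hq (x * c) x⁻¹
    have h₂ := hq x c
    rw [hinv] at h₁
    have h₃ := neg_abs_le (q c)
    have h₄ := le_abs_self (q c)
    rw [abs_le] at h₁ h₂ ⊢
    constructor <;> omega
  have hC : 0 ≤ C := (abs_nonneg _).trans (hq 1 1)
  have hprod : ∀ l : List G, (∀ c ∈ l, IsConj g c ∨ IsConj g⁻¹ c) →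
      |q l.prod| ≤ l.length * (|q g| + 3 * C) := by
    intro l
    induction l with
    | nil => simp [h1]
    | cons c l ih =>
      intro hl
      have ih := ih fun c hc => hl c (List.mem_cons_of_mem _ hc)
      have hc : |q c| ≤ |q g| + 2 * C := by
        rcases hl c (by simp) with h | h
        · obtain ⟨x, rfl⟩ := isConj_iff.1 h
          exact hconj x g
        · obtain ⟨x, rfl⟩ := isConj_iff.1 h
          have := hconj x g⁻¹
          rwa [hinv, abs_neg] at this
      have h₁ := hq c l.prod
      have h₂ : |q (c * l.prod)| ≤ C + |q c| + |q l.prod| := by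
        have e : q (c * l.prod) = (q (c * l.prod) - q c - q l.prod) + q c + q l.prod := by ring
        rw [e]
        refine (abs_add_three _ _ _).trans ?_
        omega
      rw [List.prod_cons, List.length_cons]
      push_cast
      linarith
  obtain ⟨h, hh⟩ := hub (N * (|q g| + 3 * C) + 1).toNat
  have hpos : 0 ≤ |q g| + 3 * C := by positivity
  have hpos' : 0 ≤ N * (|q g| + 3 * C) := by positivity
  obtain ⟨l, hl, hlc, rfl⟩ := hN g h (hne g (by push_cast at hg; omega)) (hne h (by omega))
  have h₁ := hprod l hlc
  have h₂ : (l.length : ℤ) * (|q g| + 3 * C) ≤ N * (|q g| + 3 * C) :=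
    mul_le_mul_of_nonneg_right (by exact_mod_cast hl) hpos
  have h₃ := le_abs_self (q l.prod)
  omega

variable {V : Type*} {A : SimpleGraph V}

/-- Cut the three sides at the center of the tripod: each leg is counted twice, with opposite signs.
Four cuts cost at most `w.length` each, so the constant `6` has slack. -/
theorem abs_signedOcc_geod_le (hA : A.IsTree) (κ : V → Bool) (w : List Bool) (x y z : V) :
    |signedOcc w ((x :: geod hA x z).map κ) - signedOcc w ((x :: geod hA x y).map κ)
      - signedOcc w ((y :: geod hA y z).map κ)| ≤ 6 * w.length := by
  obtain ⟨c, m, a, b, h₁, h₂, h₃⟩ :=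
    nonBack_tripod _ _ y (nonBack_geod hA y x) (nonBack_geod hA y z)
  have h₄ : a.reverse ++ m :: b = x :: geod hA x z := by
    refine eq_cons_geod hA h₃ ?_ ?_
    · have := getLast_geod hA y x
      rw [h₁, List.getLast?_append_cons] at this
      rw [← this]
      rcases List.eq_nil_or_concat a with rfl | ⟨a, u, rfl⟩
      · rfl
      · rw [List.concat_eq_append, ← List.cons_append, List.getLast?_append_cons]
        simp
    · have := getLast_geod hA y z
      rw [h₂, List.getLast?_append_cons] at this
      rw [← this, List.getLast?_append_cons]
  have h₅ : signedOcc w ((x :: geod hA x y).map κ) = -signedOcc w ((y :: geod hA y x).map κ) := by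
    rw [← geod_reverse hA y x, List.map_reverse, signedOcc_reverse]
  rw [h₅, h₁, h₂, ← h₄]
  simp only [List.map_append, List.map_reverse, List.map_cons]
  have e₁ := abs_signedOcc_append w (a.map κ).reverse (κ m :: b.map κ)
  have e₂ := abs_signedOcc_append w (c.map κ) (κ m :: a.map κ)
  have e₃ := abs_signedOcc_append w (c.map κ) (κ m :: b.map κ)
  have e₄ := abs_signedOcc_append w [κ m] (a.map κ)
  have e₅ := abs_signedOcc_singleton w (κ m)
  rw [signedOcc_reverse] at e₁
  rw [List.singleton_append] at e₄
  rw [abs_le] at *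
  constructor <;> omega

/-- Invariance of `κ` turns the side from `g p` to `g (h p)` into the one from `p` to `h p`, which
gives quasi-additivity; reversing geodesics gives antisymmetry. -/
theorem not_isBoundedlySimple_of_gaps (hA : A.IsTree) (κ : V → Bool) (H : Subgroup (A ≃g A))
    (hκ : ∀ g ∈ H, ∀ x, κ (g x) = κ x) (p : V) {a b c : ℕ} (hab : a ≠ b) (hac : a ≠ c)
    (hbc : b ≠ c)
    (hgap : ∀ n, ∃ g ∈ H, ∃ l, NonBack A (p :: l) ∧ (p :: l).getLast? = some (g p) ∧
      (p :: l).map κ = gapWord (periodicGaps a b c n)) :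
    ¬ IsBoundedlySimple H := by
  refine not_isBoundedlySimple_of_quasimorphism
    (fun g : H => signedOcc (gapWord [a, b]) ((p :: geod hA p (g.1 p)).map κ))
    (6 * (gapWord [a, b]).length) ?_ ?_ ?_
  · rintro ⟨g, hg⟩ ⟨h, hh⟩
    have h₁ := abs_signedOcc_geod_le hA κ (gapWord [a, b]) p (g p) (g (h p))
    rw [← geod_map hA g p (h p), List.map_map,
      show κ ∘ g = κ from funext fun x => hκ g hg x] at h₁
    exact h₁
  · rintro ⟨g, hg⟩
    have h₁ := geod_map hA g (g⁻¹ p) p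
    rw [RelIso.apply_inv_self] at h₁
    show signedOcc _ ((p :: geod hA p (g⁻¹ p)).map κ) = -signedOcc _ ((p :: geod hA p (g p)).map κ)
    rw [← h₁, List.map_map, show κ ∘ g = κ from funext fun x => hκ g hg x,
      ← geod_reverse hA p, List.map_reverse, signedOcc_reverse, neg_neg]
  · intro n
    obtain ⟨g, hg, l, hl, hlast, hw⟩ := hgap n
    refine ⟨⟨g, hg⟩, ?_⟩
    show (n : ℤ) ≤ signedOcc _ ((p :: geod hA p (g p)).map κ)
    rw [← eq_cons_geod hA hl rfl hlast, hw]
    exact le_signedOcc_periodicGaps hab hac hbc n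

end Quasimorphism

/-! ### Extending local isomorphisms of a normally colored tree -/

section Extension

variable {V : Type*} {I : Type*} {A : SimpleGraph V} {f : V → I}

/-- A locally bijective endomorphism of a tree is an automorphism. -/
theorem exists_iso_of_locally_bijective (hA : A.IsTree) (F : V → V)
    (hF : ∀ x y, A.Adj x y → A.Adj (F x) (F y))
    (hinj : ∀ x y z, A.Adj x y → A.Adj x z → F y = F z → y = z)
    (hsurj : ∀ x v, A.Adj (F x) v → ∃ y, A.Adj x y ∧ F y = v) :
    ∃ φ : A ≃g A, ∀ x, φ x = F x := by
  have hFi : Function.Injective F := by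
    intro x y hxy
    -- The image of a geodesic does not backtrack, hence repeats no vertex.
    have h := ((nonBack_geod hA x y).map F hF hinj).nodup hA
    exact List.inj_on_of_nodup_map h (by simp) (List.mem_of_getLast? (getLast_geod hA x y)) hxy
  have hFs : Function.Surjective F := by
    intro v
    obtain ⟨x⟩ := hA.connected.nonempty
    obtain ⟨p⟩ := hA.connected (F x) v
    generalize hu : F x = u at p
    induction p generalizing x with
    | nil => exact ⟨x, hu⟩
    | cons h p ih =>
      subst hu
      obtain ⟨y, -, hy⟩ := hsurj x _ h
      exact ih y hy
  refine ⟨⟨Equiv.ofBijective F ⟨hFi, hFs⟩, ?_⟩, fun x => rfl⟩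
  intro x y
  refine ⟨fun h => ?_, hF x y⟩
  obtain ⟨z, hz, hzy⟩ := hsurj x _ h
  rwa [← hFi hzy]

/-- A color-preserving permutation of the vertices which is an isomorphism at the vertex `x`. -/
def IsLocalIso (A : SimpleGraph V) (f : V → I) (x : V) (σ : Equiv.Perm V) : Prop :=
  (∀ u, f (σ u) = f u) ∧ ∀ u, A.Adj x u ↔ A.Adj (σ x) (σ u)

/-- Normality supplies `α` with `α x = σ x`. Both `α y` and `σ y` are neighbors of `σ x` of the same
color, so swapping them corrects `α` at `y`. -/
theorem IsLocalIso.exists_step (hf : IsNormalColoring A f) {x y : V} (hxy : A.Adj x y)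
    {σ : Equiv.Perm V} (hσ : IsLocalIso A f y σ) :
    ∃ τ, IsLocalIso A f x τ ∧ τ x = σ x ∧ τ y = σ y := by
  classical
  obtain ⟨α, hα, hαx⟩ := hf.2 x (σ x) (hσ.1 x).symm
  have h₁ : A.Adj (σ x) (α y) := hαx ▸ α.map_rel_iff.2 hxy
  have h₂ : A.Adj (σ x) (σ y) := ((hσ.2 x).1 hxy.symm).symm
  have hc : f (α y) = f (σ y) := (hα y).trans (hσ.1 y).symm
  have hx : Equiv.swap (α y) (σ y) (α x) = σ x := by
    rw [hαx]
    exact Equiv.swap_apply_of_ne_of_ne (A.ne_of_adj h₁) (A.ne_of_adj h₂)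
  refine ⟨α.toEquiv.trans (Equiv.swap (α y) (σ y)), ⟨fun u => ?_, fun u => ?_⟩, hx, ?_⟩
  · show f (Equiv.swap (α y) (σ y) (α u)) = f u
    rw [← hα u, Equiv.swap_apply_def]
    split_ifs with e₁ e₂
    · rw [e₁, hc]
    · rw [e₂, hc]
    · rfl
  · show A.Adj x u ↔ A.Adj (Equiv.swap (α y) (σ y) (α x)) (Equiv.swap (α y) (σ y) (α u))
    rw [hx, ← α.map_rel_iff, hαx, Equiv.swap_apply_def]
    split_ifs with e₁ e₂
    · rw [e₁]
      exact iff_of_true h₁ h₂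
    · rw [e₂]
      exact iff_of_true h₂ h₁
    · rfl
  · exact Equiv.swap_apply_left _ _

/-- A local isomorphism at `x` which agrees at `x` and `y` with the local isomorphism `σ` at `y`,
if there is one. -/
noncomputable def nextLocalIso (A : SimpleGraph V) (f : V → I) (x y : V) (σ : Equiv.Perm V) :
    Equiv.Perm V :=
  open Classical in
  if h : ∃ τ, IsLocalIso A f x τ ∧ τ x = σ x ∧ τ y = σ y then h.choose else σ

/-- The continuation of a local isomorphism at `r` along a walk. -/
noncomputable def localIsoAlong (A : SimpleGraph V) (f : V → I) {r : V} (σ : Equiv.Perm V) :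
    {x : V} → A.Walk x r → Equiv.Perm V
  | _, .nil => σ
  | x, .cons (v := y) _ p => nextLocalIso A f x y (localIsoAlong A f σ p)

theorem nextLocalIso_spec (hf : IsNormalColoring A f) {x y : V} (hxy : A.Adj x y)
    {σ : Equiv.Perm V} (hσ : IsLocalIso A f y σ) :
    IsLocalIso A f x (nextLocalIso A f x y σ) ∧ nextLocalIso A f x y σ x = σ x ∧
      nextLocalIso A f x y σ y = σ y := by
  have h := hσ.exists_step hf hxy
  rw [nextLocalIso, dif_pos h]
  exact h.choose_spec

theorem isLocalIso_localIsoAlong (hf : IsNormalColoring A f) {r : V} {σ : Equiv.Perm V}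
    (hσ : IsLocalIso A f r σ) {x : V} (p : A.Walk x r) :
    IsLocalIso A f x (localIsoAlong A f σ p) := by
  induction p with
  | nil => exact hσ
  | cons h p ih => exact (nextLocalIso_spec hf h (ih hσ)).1

/-- In a tree with a normal coloring, every local isomorphism extends to an automorphism. -/
theorem exists_colorAut_extending (hA : A.IsTree) (hf : IsNormalColoring A f) {r : V}
    {σ : Equiv.Perm V} (hσ : IsLocalIso A f r σ) :
    ∃ φ ∈ colorAut A f, φ r = σ r ∧ ∀ u, A.Adj r u → φ u = σ u := by
  classical
  choose P hP hPu using fun x => hA.existsUnique_path x r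
  have hloc := fun x => isLocalIso_localIsoAlong hf hσ (P x)
  set τ : V → Equiv.Perm V := fun x => localIsoAlong A f σ (P x) with hτ
  have hcons : ∀ x y (h : A.Adj x y), x ∉ (P y).support →
      τ x x = τ y x ∧ τ x y = τ y y := by
    intro x y h hx
    have : P x = .cons h (P y) := ((hPu x) _ ((SimpleGraph.Walk.cons_isPath_iff _ _).2 ⟨hP y, hx⟩)).symm
    simp only [hτ, this, localIsoAlong]
    exact (nextLocalIso_spec hf h (hloc y)).2
  have hagree : ∀ x y, A.Adj x y → τ y y = τ x y := by
    intro x y h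
    -- Of two adjacent vertices, one is off the path from the other to `r`: otherwise each path
    -- would contain the other as a final segment.
    by_cases hx : x ∈ (P y).support
    · by_cases hy : y ∈ (P x).support
      · exfalso
        have e₁ := hPu x _ ((hP y).dropUntil hx)
        have e₂ := hPu y _ ((hP x).dropUntil hy)
        have l₁ := congrArg SimpleGraph.Walk.length ((P y).take_spec hx)
        have l₂ := congrArg SimpleGraph.Walk.length ((P x).take_spec hy)
        rw [e₁, SimpleGraph.Walk.length_append] at l₁
        rw [e₂, SimpleGraph.Walk.length_append] at l₂
        exact A.ne_of_adj h (SimpleGraph.Walk.eq_of_length_eq_zero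
          (p := (P x).takeUntil y hy) (by omega))
      · exact (hcons y x h.symm hy).1
    · exact (hcons x y h hx).2.symm
  obtain ⟨φ, hφ⟩ := exists_iso_of_locally_bijective hA (fun x => τ x x)
    (fun x y h => by
      simp only [hagree x y h]
      exact ((hloc x).2 y).1 h)
    (fun x y z hy hz e => by
      simp only [hagree x y hy, hagree x z hz] at e
      exact (τ x).injective e)
    (fun x v h => by
      have h₁ : A.Adj x ((τ x).symm v) := by
        rw [(hloc x).2, Equiv.apply_symm_apply]
        exact h
      exact ⟨_, h₁, by simp only [hagree _ _ h₁, Equiv.apply_symm_apply]⟩)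
  have hr : τ r = σ := by
    have : P r = .nil := (hPu r _ .nil).symm
    simp only [hτ, this, localIsoAlong]
  refine ⟨φ, fun x => (congrArg f (hφ x)).trans ((hloc x).1 x), by rw [hφ, hr], fun u hu => ?_⟩
  rw [hφ, hagree r u hu, hr]

theorem colorAutPlus_le : colorAutPlus A f ≤ colorAut A f :=
  (Subgroup.closure_le _).2 fun _ hψ => hψ.1

/-- Two neighbors of `r` of the same color are exchanged by an element of `Aut_f⁺(A)` fixing `r`,
provided that `r` has a third neighbor. -/
theorem exists_colorAutPlus_rotation (hA : A.IsTree) (hf : IsNormalColoring A f) {r z z' w : V}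
    (hz : A.Adj r z) (hz' : A.Adj r z') (hw : A.Adj r w) (hwz : w ≠ z) (hwz' : w ≠ z')
    (hc : f z = f z') : ∃ φ ∈ colorAutPlus A f, φ r = r ∧ φ z = z' := by
  classical
  have hr : Equiv.swap z z' r = r :=
    Equiv.swap_apply_of_ne_of_ne (A.ne_of_adj hz) (A.ne_of_adj hz')
  obtain ⟨φ, hφ, h₁, h₂⟩ := exists_colorAut_extending hA hf (r := r) (σ := Equiv.swap z z')
    ⟨fun u => by
      rw [Equiv.swap_apply_def]
      split_ifs with e₁ e₂
      · rw [e₁, hc]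
      · rw [e₂, hc]
      · rfl, fun u => by
      rw [hr, Equiv.swap_apply_def]
      split_ifs with e₁ e₂
      · rw [e₁]
        exact iff_of_true hz hz'
      · rw [e₂]
        exact iff_of_true hz' hz
      · rfl⟩
  refine ⟨φ, Subgroup.subset_closure ⟨hφ, r, w, hw, h₁.trans hr, ?_⟩, h₁.trans hr, ?_⟩
  · rw [h₂ w hw, Equiv.swap_apply_of_ne_of_ne hwz hwz']
  · rw [h₂ z hz, Equiv.swap_apply_left]

end Extension

/-! ### Turns, their lifts, and the moves they produce -/

section Turns

variable {V : Type*} {V' : Type*} {I : Type*} {A : SimpleGraph V} {A' : SimpleGraph V'}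
  {f : V → I} {f' : V' → I}

theorem NonBack.of_append : ∀ (l₁ : List V) {l₂ : List V}, NonBack A (l₁ ++ l₂) → NonBack A l₂
  | [], _, h => h
  | _ :: l₁, _, h => NonBack.of_append l₁ h.tail

/-- A walk `…, z, r, z'` without backtracking such that `z` and `z'` have the same color and `r`
has a third neighbor. -/
def IsTurn (A : SimpleGraph V) (f : V → I) (l : List V) : Prop :=
  NonBack A l ∧ ∃ l₀ z r z' w, l = l₀ ++ [z, r, z'] ∧ f z = f z' ∧ A.Adj r w ∧ w ≠ z ∧ w ≠ z'

/-- For vertices of the same color, each color seen by the first one occurs equally often among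
their neighbors. -/
def LocallyEmbeds (A : SimpleGraph V) (f : V → I) (A' : SimpleGraph V') (f' : V' → I) : Prop :=
  ∀ x x', f x = f' x' → ∀ y, A.Adj x y →
    Nonempty ({u // A.Adj x u ∧ f u = f y} ≃ {u // A'.Adj x' u ∧ f' u = f y})

theorem IsNormalColoring.locallyEmbeds (hf : IsNormalColoring A f) : LocallyEmbeds A f A f := by
  intro x x' h y _
  obtain ⟨φ, hφ, rfl⟩ := hf.2 x x' h
  exact ⟨φ.toEquiv.subtypeEquiv fun u => and_congr φ.map_rel_iff.symm (by
    show _ ↔ f (φ u) = f y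
    rw [hφ u])⟩

theorem LocallyEmbeds.exists_adj (h : LocallyEmbeds A f A' f') {x y : V} {x' : V'}
    (hx : f x = f' x') (hxy : A.Adj x y) : ∃ y', A'.Adj x' y' ∧ f' y' = f y := by
  obtain ⟨e⟩ := h x x' hx y hxy
  exact ⟨_, (e ⟨y, hxy, rfl⟩).2⟩

theorem LocallyEmbeds.exists_adj_ne (h : LocallyEmbeds A f A' f') {x y z : V} {y' : V'}
    (hy : f y = f' y') (hyx : A.Adj y x) (hyz : A.Adj y z) (hxz : x ≠ z) (x' : V')
    (hx : f x = f' x') : ∃ z', A'.Adj y' z' ∧ x' ≠ z' ∧ f' z' = f z := by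
  obtain ⟨e⟩ := h y y' hy z hyz
  by_cases hc : f x = f z
  · have hne : (e ⟨x, hyx, hc⟩).1 ≠ (e ⟨z, hyz, rfl⟩).1 := fun he =>
      hxz (congrArg Subtype.val (e.injective (Subtype.ext he)))
    by_cases h₁ : x' = (e ⟨z, hyz, rfl⟩).1
    · exact ⟨_, (e ⟨x, hyx, hc⟩).2.1, fun h₂ => hne (h₂.symm.trans h₁), (e ⟨x, hyx, hc⟩).2.2⟩
    · exact ⟨_, (e ⟨z, hyz, rfl⟩).2.1, h₁, (e ⟨z, hyz, rfl⟩).2.2⟩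
  · exact ⟨_, (e ⟨z, hyz, rfl⟩).2.1, fun h₁ => hc (by
      rw [hx, h₁, (e ⟨z, hyz, rfl⟩).2.2]), (e ⟨z, hyz, rfl⟩).2.2⟩

/-- The bijections for the single colors assemble to an injection of the neighbors of `r` into those
of `r'`, so `r'` has at least three neighbors. -/
theorem LocallyEmbeds.exists_third (h : LocallyEmbeds A f A' f') {r z z' w : V} {r' : V'}
    (hr : f r = f' r') (hz : A.Adj r z) (hz' : A.Adj r z') (hw : A.Adj r w) (hzz : z ≠ z')
    (hwz : w ≠ z) (hwz' : w ≠ z') (a b : V') : ∃ w', A'.Adj r' w' ∧ w' ≠ a ∧ w' ≠ b := by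
  classical
  have e := fun u hu => Classical.choice (h r r' hr u hu)
  have hex : ∀ c, ∃ g : {u // A.Adj r u ∧ f u = c} → V', Function.Injective g ∧
      ∀ u, A'.Adj r' (g u) ∧ f' (g u) = c := by
    intro c
    by_cases hc : ∃ u, A.Adj r u ∧ f u = c
    · obtain ⟨u, hu, rfl⟩ := hc
      exact ⟨fun v => (e u hu v).1, Subtype.val_injective.comp (e u hu).injective,
        fun v => (e u hu v).2⟩
    · have : IsEmpty {u // A.Adj r u ∧ f u = c} := ⟨fun u => hc ⟨u.1, u.2⟩⟩
      exact ⟨isEmptyElim, Function.injective_of_subsingleton _, isEmptyElim⟩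
  choose g hgi hg using hex
  set G : {u // A.Adj r u} → V' := fun u => g (f u.1) ⟨u.1, u.2, rfl⟩ with hG
  have hGa : ∀ u, A'.Adj r' (G u) := fun u => (hg _ _).1
  have key : ∀ (u v : V) (c : I) (hu : A.Adj r u ∧ f u = c) (hv : A.Adj r v ∧ f v = f v),
      f v = c → g c ⟨u, hu⟩ = g (f v) ⟨v, hv⟩ → u = v := by
    rintro u v c hu hv rfl he
    exact congrArg Subtype.val (hgi _ he)
  have hGi : ∀ u v, G u = G v → u.1 = v.1 := by
    intro u v he
    have hc : f v.1 = f u.1 := by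
      rw [← (hg (f u.1) ⟨u.1, u.2, rfl⟩).2, ← (hg (f v.1) ⟨v.1, v.2, rfl⟩).2]
      exact congrArg f' he.symm
    exact key u.1 v.1 _ _ _ hc he
  by_contra! hno
  have h₁ := hno _ (hGa ⟨z, hz⟩)
  have h₂ := hno _ (hGa ⟨z', hz'⟩)
  have h₃ := hno _ (hGa ⟨w, hw⟩)
  have n₁ : G ⟨z, hz⟩ ≠ G ⟨z', hz'⟩ := fun he => hzz (hGi _ _ he)
  have n₂ : G ⟨w, hw⟩ ≠ G ⟨z, hz⟩ := fun he => hwz (hGi _ _ he)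
  have n₃ : G ⟨w, hw⟩ ≠ G ⟨z', hz'⟩ := fun he => hwz' (hGi _ _ he)
  by_cases ha : G ⟨z, hz⟩ = a
  · have hb := h₂ fun h => n₁ (ha.trans h.symm)
    exact n₃ ((h₃ fun h => n₂ (h.trans ha.symm)).trans hb.symm)
  · have hb := h₁ ha
    by_cases ha' : G ⟨z', hz'⟩ = a
    · exact n₂ ((h₃ fun h => n₃ (h.trans ha'.symm)).trans hb.symm)
    · exact n₁ (hb.trans (h₂ ha').symm)

theorem LocallyEmbeds.exists_lift (h : LocallyEmbeds A f A' f') :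
    ∀ (l : List V) {x y : V} {x' y' : V'}, NonBack A (x :: y :: l) → A'.Adj x' y' → f x = f' x' →
      f y = f' y' → ∃ l', NonBack A' (x' :: y' :: l') ∧ l'.map f' = l.map f
  | [], _, _, _, _, _, hxy', _, _ => ⟨[], hxy', rfl⟩
  | z :: l, x, y, x', y', hn, hxy', hx, hy => by
    obtain ⟨z', hz', hne, hc⟩ := h.exists_adj_ne hy hn.adj.symm hn.tail.adj hn.2.1 x' hx
    obtain ⟨l', hl', hm⟩ := h.exists_lift l hn.tail hz' hy hc.symm
    exact ⟨z' :: l', ⟨hxy', hne, hl'⟩, by simp [hc, hm]⟩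

theorem LocallyEmbeds.exists_lift_turn (h : LocallyEmbeds A f A' f') {l : List V} {x y : V}
    {x' y' : V'} (hn : IsTurn A f (x :: y :: l)) (hxy' : A'.Adj x' y') (hx : f x = f' x')
    (hy : f y = f' y') : ∃ l', IsTurn A' f' (x' :: y' :: l') ∧ l'.map f' = l.map f := by
  obtain ⟨hn, l₀, z, r, z', w, e, hc, hw, hwz, hwz'⟩ := hn
  obtain ⟨l', hl', hm⟩ := h.exists_lift l hn hxy' hx hy
  refine ⟨l', ⟨hl', ?_⟩, hm⟩
  have hm' : (x' :: y' :: l').map f' = l₀.map f ++ [z, r, z'].map f := by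
    rw [← List.map_append, ← e]
    simp [hx, hy, hm]
  obtain ⟨l₁, l₂, e', -, hl₂⟩ := List.map_eq_append_iff.1 hm'
  obtain ⟨z₁, l₂, rfl, hz₁, hl₂⟩ := List.map_eq_cons_iff.1 hl₂
  obtain ⟨r₁, l₂, rfl, hr₁, hl₂⟩ := List.map_eq_cons_iff.1 hl₂
  obtain ⟨z₁', l₂, rfl, hz₁', hl₂⟩ := List.map_eq_cons_iff.1 hl₂
  obtain rfl := List.map_eq_nil_iff.1 hl₂
  have ht : NonBack A [z, r, z'] := NonBack.of_append l₀ (e ▸ hn)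
  obtain ⟨w₁, hw₁, h₁, h₂⟩ := h.exists_third hr₁.symm ht.adj.symm ht.tail.adj hw ht.2.1 hwz hwz'
    z₁ z₁'
  exact ⟨l₁, z₁, r₁, z₁', w₁, e', by rw [hz₁, hz₁', hc], hw₁, h₁, h₂⟩

/-- Follow the walk from a fixed edge to the first moved vertex `z`; the fixed vertex just before
its predecessor (initially `w`) is `w'`. -/
theorem exists_fixed_unfixed (φ : A ≃g A) {x : V} (hx : φ x ≠ x) : ∀ (l : List V) (w r : V),
    φ w = w → A.Adj r w → φ r = r → NonBack A (r :: l) → (r :: l).getLast? = some x →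
      ∃ l₁ l₂ r' z w', r :: l = l₁ ++ r' :: z :: l₂ ∧ φ r' = r' ∧ φ z ≠ z ∧ A.Adj r' w' ∧
        φ w' = w' ∧ (z :: l₂).getLast? = some x
  | [], w, r, _, _, hr, _, hl => by
    obtain rfl : r = x := by simpa using hl
    exact absurd hr hx
  | z :: l, w, r, hw, hrw, hr, hn, hl => by
    by_cases hz : φ z = z
    · obtain ⟨l₁, l₂, r', z', w', e, h⟩ :=
        exists_fixed_unfixed φ hx l r z hr hn.adj.symm hz hn.tail (by simpa using hl)
      exact ⟨r :: l₁, l₂, r', z', w', by rw [e]; rfl, h⟩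
    · exact ⟨[], l, r, z, w, rfl, hr, hz, hrw, hw, by simpa using hl⟩

/-- If `Aut_f⁺(A)` does not fix `x`, then some turn starts at `x`. -/
theorem exists_isTurn (hA : A.IsTree) {x : V} (hx : ¬∀ φ ∈ colorAutPlus A f, φ x = x) :
    ∃ l, IsTurn A f (x :: l) := by
  obtain ⟨φ, hφ, u, v, huv, hu, hv, hφx⟩ : ∃ φ ∈ colorAut A f, ∃ u v, A.Adj u v ∧ φ u = u ∧
      φ v = v ∧ φ x ≠ x := by
    by_contra! hno
    refine hx fun φ hφ => ?_
    have : colorAutPlus A f ≤ MulAction.stabilizer (A ≃g A) x :=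
      (Subgroup.closure_le _).2 fun ψ ⟨hψ, u, v, huv, hu, hv⟩ => hno ψ hψ u v huv hu hv
    exact this hφ
  obtain ⟨l₁, l₂, r, z, w, e, hr, hz, hrw, hw, hl⟩ := exists_fixed_unfixed φ hφx (geod hA u x) v u
    hv huv hu (nonBack_geod hA u x) (getLast_geod hA u x)
  have hn : NonBack A (r :: z :: l₂) := NonBack.of_append l₁ (e ▸ nonBack_geod hA u x)
  have hadj : A.Adj r (φ z) := by
    have := φ.map_rel_iff.2 hn.adj
    rwa [hr] at this
  -- Walk back from `x` to `z` and `r`, then on to `φ z`; the fixed neighbor `w` of `r` is the third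
  -- one.
  have ht : IsTurn A f ((z :: l₂).reverse ++ [r, φ z]) := by
    refine ⟨?_, l₂.reverse, z, r, φ z, w, by simp, (hφ z).symm, hrw, ?_, ?_⟩
    · have := hn.reverse
      simp only [List.reverse_cons, List.append_assoc, List.cons_append,
        List.nil_append] at this ⊢
      rw [nonBack_glue]
      exact ⟨this, hn.adj.symm, hz.symm, hadj⟩
    · rintro rfl
      exact hz hw
    · rintro rfl
      exact hz (φ.injective hw)
  rcases List.eq_nil_or_concat (z :: l₂) with h | ⟨l₃, x', h⟩
  · simp at h
  · rw [List.concat_eq_append] at h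
    rw [h] at ht hl
    obtain rfl : x' = x := by simpa using hl
    exact ⟨_, by simpa using ht⟩

theorem IsTurn.exists_cons_cons {l : List V} (h : IsTurn A f l) :
    ∃ x y l', l = x :: y :: l' := by
  obtain ⟨-, _ | ⟨x, _ | ⟨y, l₀⟩⟩, z, r, z', w, rfl, -⟩ := h
  exacts [⟨_, _, _, rfl⟩, ⟨_, _, _, rfl⟩, ⟨_, _, _, rfl⟩]

theorem exists_isTurn_length_ge (hAA : LocallyEmbeds A f A f)
    (ht : ∀ x, ∃ l, IsTurn A f (x :: l)) (x : V) :
    ∀ n, ∃ l, IsTurn A f (x :: l) ∧ n ≤ l.length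
  | 0 => (ht x).imp fun _ h => ⟨h, Nat.zero_le _⟩
  | n + 1 => by
    obtain ⟨l, ⟨hn, l₀, z, r, z', w, e, hc, hw, hwz, hwz'⟩, hlen⟩ :=
      exists_isTurn_length_ge hAA ht x n
    have hzr : NonBack A [z, r, z'] := NonBack.of_append l₀ (e ▸ hn)
    obtain ⟨l₂, h₂⟩ := ht r
    obtain ⟨r₀, y, l₃, e₂⟩ := h₂.exists_cons_cons
    obtain ⟨rfl, rfl⟩ := List.cons.inj e₂
    -- A turn from `r` prolongs the given one. If its first step returned to `z`, it is redirected
    -- to `z'`, of the same color, by lifting the turn within `A`.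
    obtain ⟨y', hy', hyz, hcy⟩ : ∃ y', A.Adj r y' ∧ z ≠ y' ∧ f y = f y' := by
      by_cases hy : y = z
      · exact ⟨z', hzr.tail.adj, hzr.2.1, by rw [hy, hc]⟩
      · exact ⟨y, h₂.1.adj, fun h => hy h.symm, rfl⟩
    obtain ⟨l', ⟨hn', l₄, z₁, r₁, z₁', w₁, e', h'⟩, -⟩ :=
      hAA.exists_lift_turn h₂ hy' rfl hcy
    have hnew : IsTurn A f (l₀ ++ z :: r :: y' :: l') := by
      refine ⟨(nonBack_glue _ _ _ _).2 ⟨?_, hzr.adj, hyz, hn'⟩, l₀ ++ z :: l₄, z₁, r₁, z₁', w₁,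
        by rw [e']; simp, h'⟩
      rw [e] at hn
      exact ((nonBack_glue l₀ z r [z']).1 hn).1
    have hl₁ := congrArg List.length e
    have hl₂ := congrArg List.length e'
    rcases l₀ with _ | ⟨x₀, l₀⟩
    · obtain ⟨rfl, -⟩ := List.cons.inj e
      exact ⟨_, hnew, by simp at *; omega⟩
    · obtain ⟨rfl, -⟩ := List.cons.inj e
      exact ⟨_, hnew, by simp at *; omega⟩

/-- `g` moves `p` along a walk without backtracking through `m` vertices with label `false` which
leaves `p` through `y` and reaches `g p` through `g y`. -/
def MovesAcross (A : SimpleGraph V) (κ : V → Bool) (p y : V) (g : A ≃g A) (m : ℕ) : Prop :=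
  ∃ t, NonBack A (p :: y :: (t ++ [g y, g p])) ∧
    (y :: (t ++ [g y])).map κ = List.replicate m false

/-- The `g`-image of the walk for `h` is attached after `g y, g p`; it does not backtrack there
because the walk for `h` can be preceded by `y`. Requiring `y' ≠ y` preserves this form for the next
factor. -/
theorem MovesAcross.mul {κ : V → Bool} {p y y' : V} {g h : A ≃g A} {m : ℕ} {ms : List ℕ}
    (hg : MovesAcross A κ p y g m) (hκ : ∀ x, κ (g x) = κ x) (hp : κ p = true)
    (hy : A.Adj y' p) (hne : y' ≠ y)
    (hh : ∃ l, NonBack A (y :: p :: l) ∧ (p :: l).getLast? = some (h p) ∧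
      (p :: l).map κ = gapWord ms) :
    ∃ l, NonBack A (y' :: p :: l) ∧ (p :: l).getLast? = some ((g * h) p) ∧
      (p :: l).map κ = gapWord (m :: ms) := by
  obtain ⟨t, ht, hm⟩ := hg
  obtain ⟨l, hl, hlast, hw⟩ := hh
  refine ⟨y :: (t ++ g y :: (p :: l).map g), ⟨hy, hne, ?_⟩, ?_, ?_⟩
  · have := (nonBack_glue (p :: y :: t) (g y) (g p) (l.map g)).2
      ⟨by simpa using ht, hl.map_iso g⟩
    simpa using this
  · have h₁ : p :: y :: (t ++ g y :: (p :: l).map g) = (p :: y :: (t ++ [g y])) ++ g p :: l.map g := by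
      simp
    rw [h₁, List.getLast?_append_cons, ← List.map_cons, List.getLast?_map, hlast]
    rfl
  · have h₂ : ((p :: l).map g).map κ = gapWord ms := by
      rw [List.map_map, show κ ∘ g = κ from funext hκ, hw]
    have h₁ : p :: y :: (t ++ g y :: (p :: l).map g) = p :: ((y :: (t ++ [g y])) ++ (p :: l).map g) := by
      simp
    rw [h₁, List.map_cons, List.map_append, hm, h₂, hp, gapWord]

/-- Rotate at the bend `r`, taking `z` to `z'`, and return along the image of the walk. The gap
consists of `z, r, z'` and two copies of the initial part, which has `l.length - 2` vertices. -/
theorem IsTurn.exists_movesAcross (hA : A.IsTree) (hf : IsNormalColoring A f) {κ : V → Bool}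
    (hκ : ∀ x y, f x = f y → κ x = κ y) {p y : V} {l : List V} (hl : IsTurn A f (y :: l))
    (hn : NonBack A (p :: y :: l)) (hlκ : ∀ x ∈ y :: l, κ x = false) :
    ∃ g ∈ colorAutPlus A f, MovesAcross A κ p y g (2 * (l.length - 2) + 3) := by
  obtain ⟨-, l₀, z, r, z', w, e, hc, hw, hwz, hwz'⟩ := hl
  have hzr : NonBack A [z, r, z'] := NonBack.of_append (p :: l₀) (by
    rw [e] at hn
    simpa using hn)
  obtain ⟨g, hg, hgr, hgz⟩ :=
    exists_colorAutPlus_rotation hA hf hzr.adj.symm hzr.tail.adj hw hwz hwz' hc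
  refine ⟨g, hg, ?_⟩
  have h₁ : NonBack A ((p :: l₀) ++ [z, r]) := by
    rw [e] at hn
    exact ((nonBack_glue (p :: l₀) z r [z']).1 hn).1
  have h₂ : NonBack A (r :: z' :: (p :: l₀).reverse.map g) := by
    have := h₁.reverse.map_iso g
    rw [List.reverse_append, List.map_append] at this
    simpa [hgr, hgz] using this
  have h₃ : NonBack A ((p :: l₀) ++ z :: r :: z' :: (p :: l₀).reverse.map g) :=
    (nonBack_glue _ _ _ _).2 ⟨h₁, hzr.adj, hzr.2.1, h₂⟩
  have hκg : ∀ x, κ (g x) = κ x := fun x => hκ _ _ (colorAutPlus_le hg x)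
  have hκr : ∀ x ∈ l₀ ++ [z, r], κ x = false := fun x hx => hlκ x (by
    rw [e]
    simp at hx ⊢
    tauto)
  have hlen := congrArg List.length e
  rcases l₀ with _ | ⟨y₀, l₀⟩
  · obtain ⟨rfl, rfl⟩ := List.cons.inj e
    refine ⟨[r], by simpa [hgz] using h₃, ?_⟩
    simp at hκr
    simp [List.replicate_succ, hκg, hκr]
  · obtain ⟨rfl, rfl⟩ := List.cons.inj e
    refine ⟨l₀ ++ z :: r :: z' :: l₀.reverse.map g, by simpa using h₃, ?_⟩
    rw [List.eq_replicate_iff]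
    refine ⟨by simp; omega, fun b hb => ?_⟩
    obtain ⟨x, hx, rfl⟩ := List.mem_map.1 hb
    have hz' : κ z' = κ z := (hκ _ _ hc).symm
    simp at hκr hx
    rcases hx with rfl | hx | rfl | rfl | rfl | ⟨x, hx, rfl⟩ | rfl <;> simp_all

end Turns

/-! ### Passage from `A` to `A'` and conclusion -/

theorem IsCode.locallyEmbeds_some {V V' : Type u} {I : Type v} {A : SimpleGraph V} {f : V → I}
    {a : I → I → Cardinal.{u}} (ha : IsCode A f a) {A' : SimpleGraph V'} {f' : V' → Option I}
    {a' : Option I → Option I → Cardinal.{u}} (ha' : IsCode A' f' a')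
    (hext : ∀ i j : I, a' (some i) (some j) = a i j) :
    LocallyEmbeds A (fun x => some (f x)) A' f' := by
  intro x x' hx y _
  simp only [Option.some.injEq]
  have h₁ := ha.2 x (f y)
  have h₂ := ha'.2 x' (some (f y))
  rw [← hx, hext, ← h₁] at h₂
  exact Cardinal.eq.1 h₂.symm

theorem IsNormalColoring.locallyEmbeds_some {V : Type u} {I : Type v} {A : SimpleGraph V}
    {f : V → I} (hf : IsNormalColoring A f) :
    LocallyEmbeds A (fun x => some (f x)) A (fun x => some (f x)) := by
  intro x x' hx y hy
  simpa only [Option.some.injEq] using hf.locallyEmbeds x x' (Option.some.inj hx) y hy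

theorem exists_movesAcross_of_isTurn {V V' : Type u} {I : Type v} {A : SimpleGraph V} {f : V → I}
    {A' : SimpleGraph V'} (hA' : A'.IsTree) {f' : V' → Option I} (hf' : IsNormalColoring A' f')
    (hAA' : LocallyEmbeds A (fun x => some (f x)) A' f') {p y : V'} (hp : f' p = none)
    (hpy : A'.Adj p y) {x : V} (hxy : f' y = some (f x)) {l : List V}
    (hl : IsTurn A f (x :: l)) :
    ∃ g ∈ colorAutPlus A' f',
      MovesAcross A' (fun z => (f' z).isNone) p y g (2 * (l.length - 2) + 3) := by
  have hl' : IsTurn A (fun x => some (f x)) (x :: l) := by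
    obtain ⟨hn, l₀, z, r, z', w, e, hc, hw⟩ := hl
    exact ⟨hn, l₀, z, r, z', w, e, congrArg some hc, hw⟩
  obtain ⟨x₀, x₁, l₁, e⟩ := hl.exists_cons_cons
  obtain ⟨rfl, rfl⟩ := List.cons.inj e
  obtain ⟨y₁, hy₁, hc₁⟩ := hAA'.exists_adj hxy.symm hl.1.adj
  obtain ⟨l₂, hl₂, hm⟩ := hAA'.exists_lift_turn hl' hy₁ hxy.symm hc₁.symm
  have hlen : l₁.length = l₂.length := by simpa using (congrArg List.length hm).symm
  have := hl₂.exists_movesAcross (κ := fun z => (f' z).isNone) (p := p) hA' hf'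
    (fun x y h => by simp only [h]) ⟨hpy, fun h => by simp [← h, hp] at hc₁, hl₂.1⟩ (by
      intro z hz
      have hz' : f' z ∈ (y :: y₁ :: l₂).map f' := List.mem_map_of_mem hz
      rw [List.map_cons, List.map_cons, hm, hxy, hc₁] at hz'
      simp only [List.mem_cons, List.mem_map] at hz'
      rcases hz' with h | h | ⟨_, -, h⟩
      · simp [h]
      · simp [h]
      · simp [← h])
  simpa [hlen] using this

end ColoredTree

theorem mainTheorem7 {V V' : Type u} {I : Type v}
    (A : SimpleGraph V) (hA : A.IsTree) (f : V → I)
    (a : I → I → Cardinal.{u}) (ha : ColoredTree.IsCode A f a)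
    (hfix : ¬ ∃ x : V, ∀ φ ∈ ColoredTree.colorAutPlus A f, φ x = x)
    (a' : Option I → Option I → Cardinal.{u})
    (hext : ∀ i j : I, a' (some i) (some j) = a i j)
    (hzero : ∀ i : I, a' (some i) none = 0 ↔ a' none (some i) = 0)
    (hnew : ∃ j : I, 2 ≤ a' none (some j))
    (A' : SimpleGraph V') (hA' : A'.IsTree) (f' : V' → Option I)
    (ha' : ColoredTree.IsCode A' f' a') :
    ¬ ColoredTree.IsBoundedlySimple (ColoredTree.colorAutPlus A' f') := by
  open ColoredTree in
  obtain ⟨j, hj⟩ := hnew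
  obtain ⟨p, hp⟩ := ha'.1.1 none
  obtain ⟨x, rfl⟩ := ha.1.1 j
  rw [← hp, ← ha'.2 p, Cardinal.two_le_iff] at hj
  obtain ⟨⟨y₁, hpy₁, hy₁⟩, ⟨y₂, hpy₂, hy₂⟩, hne⟩ := hj
  replace hne : y₁ ≠ y₂ := fun h => hne (Subtype.ext h)
  have hAA' := ha.locallyEmbeds_some ha' hext
  have hturn := exists_isTurn_length_ge ha.1.locallyEmbeds
    (fun x => exists_isTurn hA fun h => hfix ⟨x, h⟩) x
  have hmove : ∀ l : List V, IsTurn A f (x :: l) → ∀ y, A'.Adj p y → f' y = some (f x) →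
      ∃ g ∈ colorAutPlus A' f',
        MovesAcross A' (fun z => (f' z).isNone) p y g (2 * (l.length - 2) + 3) :=
    fun l hl y hpy hy => exists_movesAcross_of_isTurn hA' ha'.1 hAA' hp hpy hy hl
  have hκ : ∀ g ∈ colorAutPlus A' f', ∀ z, (f' (g z)).isNone = (f' z).isNone := fun g hg z => by
    rw [colorAutPlus_le hg z]
  have hκp : (f' p).isNone = true := by simp [hp]
  -- Lengths at least `2` and strictly increasing make the three gaps distinct despite truncated
  -- subtraction.
  obtain ⟨la, hla, hlena⟩ := hturn 2
  obtain ⟨lb, hlb, hlenb⟩ := hturn (la.length + 1)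
  obtain ⟨lc, hlc, hlenc⟩ := hturn (lb.length + 1)
  obtain ⟨ga, hga, hma⟩ := hmove la hla y₂ hpy₂ hy₂
  obtain ⟨gb, hgb, hmb⟩ := hmove lb hlb y₁ hpy₁ hy₁
  obtain ⟨gc, hgc, hmc⟩ := hmove lc hlc y₂ hpy₂ hy₂
  obtain ⟨gd, hgd, hmd⟩ := hmove lc hlc y₁ hpy₁ hy₁
  refine not_isBoundedlySimple_of_gaps (a := 2 * (la.length - 2) + 3)
    (b := 2 * (lb.length - 2) + 3) (c := 2 * (lc.length - 2) + 3) hA' (fun z => (f' z).isNone) _ hκ p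
    (by omega) (by omega) (by omega) fun n => ?_
  -- For the induction, the walk must also leave `p` by a neighbor other than `y₁`.
  suffices h : ∃ g ∈ colorAutPlus A' f', ∃ l, NonBack A' (y₁ :: p :: l) ∧
      (p :: l).getLast? = some (g p) ∧ (p :: l).map (fun z => (f' z).isNone) =
        gapWord (periodicGaps (2 * (la.length - 2) + 3) (2 * (lb.length - 2) + 3)
          (2 * (lc.length - 2) + 3) n) by
    obtain ⟨g, hg, l, hl, h⟩ := h
    exact ⟨g, hg, l, hl.tail, h⟩
  induction n with
  | zero => exact ⟨1, one_mem _, [], hpy₁.symm, rfl, by simp [periodicGaps, gapWord, hp]⟩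
  | succ n ih =>
    obtain ⟨g, hg, h⟩ := ih
    -- The moves use `y₂, y₁, y₂, y₁` in turn. Doubling `c` makes the period even, so the
    -- alternation closes up.
    refine ⟨ga * (gb * (gc * (gd * g))),
      mul_mem hga (mul_mem hgb (mul_mem hgc (mul_mem hgd hg))), ?_⟩
    exact hma.mul (hκ ga hga) hκp hpy₁.symm hne <| hmb.mul (hκ gb hgb) hκp hpy₂.symm hne.symm <|
      hmc.mul (hκ gc hgc) hκp hpy₁.symm hne <| hmd.mul (hκ gd hgd) hκp hpy₂.symm hne.symm h
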